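/- Let $G$ be a countable group, let $X$ be a compact metrizable space, and let $\rho\colon G\to\mathrm{Homeo}(X)$ be a homomorphism. A sequence $(g_i)_{i\in\mathbb N}$ of mutually different elements of $G$ is called a convergence sequence of $(\rho,X)$ with repelling point $r\in X$ and attracting point $a\in X$ (where $r=a$ is allowed) if $\rho(g_i)|_{X\setminus\{r\}}$ converges to $a$ uniformly on compact subsets of $X\setminus\{r\}$ and $\rho(g_i^{-1})|_{X\setminus\{a\}}$ converges to $r$ uniformly on compact subsets of $X\setminus\{a\}$. The pair $(\rho,X)$ is a convergence group action if $X$ has at least three points and every infinite sequence of mutually different elements of $G$ has a subsequence that is a convergence sequence of $(\rho,X)$. Its limit set $\Lambda(\rho)$ is the set of all repelling points and attracting points of convergence sequences of $(\rho,X)$. A convergence group action is non-elementary if $\Lambda(\rho)$ is infinite, minimal if every $\rho(G)$-orbit is dense in $X$, and effective if $\rho$ is injective. A group $H$ is a Powers group if for every finite subset $F\subset H\setminus\{1\}$ and every integer $k\ge 1$ there exist a partition $H=C\sqcup D$ and elements $\gamma_1,\dots,\gamma_k\in H$ such that $fC\cap C=\emptyset$ for all $f\in F$ and $\gamma_iD\cap\gamma_jD=\emptyset$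 for all $i\ne j$. A group is a strongly Powers group if all its non-trivial subnormal subgroups are Powers groups. Suppose that $(\rho,X)$ is an effective minimal non-elementary convergence group action of $G$. Then for every non-trivial subnormal subgroup $N$ of $G$, the restricted action $(\rho|_N,X)$ is an effective minimal non-elementary convergence group action of $N$. In particular, $G$ is a strongly Powers group. -/

import Mathlib

open Filter Topology Set

/-- The maps `f n` converge to the constant map `a` uniformly on compact subsets of `X ∖ {r}`.
As the limit is constant, uniform convergence on a compact set `K` means that each neighbourhood
of `a` eventually contains the image of `K`, for whichever compatible uniform structure on `X`. -/
def ConvergesToConstOff {X : Type*} [TopologicalSpace X] (f : ℕ → X → X) (r a : X) : Prop :=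
  ∀ K : Set X, IsCompact K → K ⊆ {r}ᶜ → ∀ U ∈ 𝓝 a, ∀ᶠ n in atTop, MapsTo (f n) K U

/-- The definition above agrees with uniform convergence in the usual sense. -/
theorem convergesToConstOff_iff {X : Type*} [UniformSpace X] (f : ℕ → X → X) (r a : X) :
    ConvergesToConstOff f r a ↔ ∀ K : Set X, IsCompact K → K ⊆ {r}ᶜ →
      TendstoUniformlyOn f (fun _ => a) atTop K := by
  refine forall_congr' fun K => forall_congr' fun _ => forall_congr' fun _ => ?_
  constructor
  · intro h u hu
    exact (h _ (UniformSpace.ball_mem_nhds a hu)).mono fun n hn x hx => hn hx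
  · intro h U hU
    obtain ⟨u, hu, huU⟩ := UniformSpace.mem_nhds_iff.1 hU
    exact (h u hu).mono fun n hn x hx => huU (hn x hx)

/-- `g` is a sequence of mutually different elements of `G` that is a convergence sequence of the
action `ρ`, with repelling point `r` and attracting point `a`. -/
structure IsConvergenceSequence {G X : Type*} [Group G] [TopologicalSpace X]
    (ρ : G →* (X ≃ₜ X)) (g : ℕ → G) (r a : X) : Prop where
  injective : Function.Injective g
  forward : ConvergesToConstOff (fun n => ρ (g n)) r a
  backward : ConvergesToConstOff (fun n => ρ (g n)⁻¹) a r

/-- The pair `(ρ, X)` is a convergence group action. The points `r` and `a` may coincide. -/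
structure IsConvergenceAction {G X : Type*} [Group G] [TopologicalSpace X]
    (ρ : G →* (X ≃ₜ X)) : Prop where
  three_points : ∃ x y z : X, x ≠ y ∧ x ≠ z ∧ y ≠ z
  exists_subseq : ∀ g : ℕ → G, Function.Injective g →
    ∃ φ : ℕ → ℕ, StrictMono φ ∧ ∃ r a : X, IsConvergenceSequence ρ (g ∘ φ) r a

/-- The limit set `Λ(ρ)`: all repelling points and attracting points of convergence sequences. -/
def convergenceLimitSet {G X : Type*} [Group G] [TopologicalSpace X]
    (ρ : G →* (X ≃ₜ X)) : Set X :=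
  {x | ∃ (g : ℕ → G) (r a : X), IsConvergenceSequence ρ g r a ∧ (x = r ∨ x = a)}

/-- `(ρ, X)` is an effective minimal non-elementary convergence group action. -/
structure IsEffectiveMinimalNonelementary {G X : Type*} [Group G] [TopologicalSpace X]
    (ρ : G →* (X ≃ₜ X)) : Prop where
  convergence : IsConvergenceAction ρ
  nonelementary : (convergenceLimitSet ρ).Infinite
  /-- minimality: every orbit is dense -/
  minimal : ∀ x : X, Dense (range fun g : G => ρ g x)
  /-- effectiveness: only the identity element acts trivially -/
  effective : Function.Injective ρ

/-- `G` is a Powers group: for every finite `F ⊆ G ∖ {1}` and every `k ≥ 1` there are a partition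
`G = C ⊔ D` and `γ₁, …, γₖ ∈ G` such that `f C ∩ C = ∅` for all `f ∈ F` and the translates
`γ₁ D, …, γₖ D` are pairwise disjoint. -/
def IsPowersGroup (G : Type*) [Group G] : Prop :=
  ∀ F : Finset G, 1 ∉ F → ∀ k : ℕ, 1 ≤ k →
    ∃ (C D : Set G) (γ : Fin k → G), C ∪ D = univ ∧ Disjoint C D ∧
      (∀ f ∈ F, Disjoint ((fun x => f * x) '' C) C) ∧
      ∀ i j : Fin k, i ≠ j → Disjoint ((fun x => γ i * x) '' D) ((fun x => γ j * x) '' D)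

/-- `G` is a strongly Powers group: all its non-trivial subnormal subgroups are Powers groups. -/
def IsStronglyPowersGroup (G : Type*) [Group G] : Prop :=
  ∀ N : Subgroup G, N.IsSubnormal → N ≠ ⊥ → IsPowersGroup N

/-!
Both halves are proved by dynamics on `X`, which is infinite because the limit set is.

*Passing to a normal subgroup `N ≠ 1`.* The points fixed by all of `N` form a closed `G`-invariant
set, hence by minimality there are none, `N` being non-trivial and the action effective
(`IsEffectiveMinimalNonelementary.exists_map_ne`). Let `gₙ` be a convergence sequence of `G` with
attracting point `a`, and let `h ∈ N` move `a`. If `gₙ⁻¹ h gₙ` were constant along a subsequence,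
`h` would fix `a`; so these conjugates take infinitely many values and `N` is infinite. Hence `N` has
convergence sequences, and its limit set, being invariant under `G`, is dense and in particular
infinite. Finally a closed `N`-invariant set with at least two points contains the limit set of `N`
(`convergenceLimitSet_subset`), so every `N`-orbit is dense. Induction along the subnormal series
gives the first claim (`IsEffectiveMinimalNonelementary.comp`).

*Powers property.* If `f` fixes a non-empty open set `U` pointwise, take a convergence sequence
`gₙ` with repelling point in `U`. The sets `gₙ U` exhaust the complement of the attracting point, and
`gₙ f gₙ⁻¹` fixes `gₙ U`. These conjugates cannot take infinitely many values, since a convergence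
sequence does not fix three points; so they are constant along a subsequence and `f = 1`
(`IsEffectiveMinimalNonelementary.dense_map_ne`). Consequently, given a finite set
`F` of non-trivial elements, some non-empty open `U` is disjoint from its translates under `F`.
Then `C = {g | g x ∈ U}` works for any point `x`: if `U` contains the repelling point of `gₙ`, large
`gₙ` compress the complement of `U` into a small neighbourhood of the attracting point `a`, and
composing with elements that move `a` to `k` different points makes the images disjoint.
-/

/-! ### Convergence sequences and limit sets -/

/-- A sequence has a subsequence that is constant or injective. -/
theorem exists_strictMono_const_or_injective {α : Type*} (u : ℕ → α) :
    ∃ φ : ℕ → ℕ, StrictMono φ ∧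
      ((∃ c, ∀ n, u (φ n) = c) ∨ Function.Injective fun n => u (φ n)) := by
  obtain ⟨φ, h | h⟩ := exists_increasing_or_nonincreasing_subseq (· = ·) u
  · refine ⟨φ, φ.strictMono, Or.inl ⟨u (φ 0), fun n => ?_⟩⟩
    rcases Nat.eq_zero_or_pos n with rfl | hn
    · rfl
    · exact (h 0 n hn).symm
  · refine ⟨φ, φ.strictMono, Or.inr fun m n hmn => ?_⟩
    rcases lt_trichotomy m n with hlt | heq | hlt
    · exact (h m n hlt hmn).elim
    · exact heq
    · exact (h n m hlt hmn.symm).elim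

/-- For a minimal action, a non-empty closed invariant set is the whole space. -/
theorem eq_univ_of_isClosed_of_forall_map_mem {G X : Type*} [Group G] [TopologicalSpace X]
    {ρ : G →* (X ≃ₜ X)} (hmin : ∀ x : X, Dense (range fun g : G => ρ g x)) {C : Set X}
    (hC : IsClosed C) (hne : C.Nonempty) (hinv : ∀ g, ∀ x ∈ C, ρ g x ∈ C) : C = univ := by
  obtain ⟨x, hx⟩ := hne
  have h : range (fun g : G => ρ g x) ⊆ C := by
    rintro _ ⟨g, rfl⟩
    exact hinv g x hx
  exact hC.closure_eq ▸ ((hmin x).mono h).closure_eq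

namespace IsConvergenceSequence

variable {G H X : Type*} [Group G] [Group H] [TopologicalSpace X] {ρ : G →* (X ≃ₜ X)}
  {g : ℕ → G} {r a : X}

theorem inv (h : IsConvergenceSequence ρ g r a) :
    IsConvergenceSequence ρ (fun n => (g n)⁻¹) a r where
  injective := inv_injective.comp h.injective
  forward := h.backward
  backward := by simpa only [inv_inv] using h.forward

theorem tendsto (h : IsConvergenceSequence ρ g r a) {x : X} (hx : x ≠ r) :
    Tendsto (fun n => ρ (g n) x) atTop (𝓝 a) := by
  intro U hU
  exact (h.forward {x} isCompact_singleton (singleton_subset_iff.2 hx) U hU).mono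
    fun n hn => hn rfl

theorem conj (h : IsConvergenceSequence ρ g r a) (k : G) :
    IsConvergenceSequence ρ (fun n => k * g n * k⁻¹) (ρ k r) (ρ k a) := by
  have key : ∀ {u : ℕ → G} {r a : X}, ConvergesToConstOff (fun n => ρ (u n)) r a →
      ConvergesToConstOff (fun n => ρ (k * u n * k⁻¹)) (ρ k r) (ρ k a) := by
    intro u r a hu K hK hKr U hU
    have hsub : ρ k⁻¹ '' K ⊆ {r}ᶜ := by
      rintro _ ⟨x, hx, rfl⟩ hxr
      refine hKr hx ?_
      rw [mem_singleton_iff] at hxr ⊢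
      rw [← hxr, ← Homeomorph.mul_apply, ← map_mul, mul_inv_cancel, map_one,
        Homeomorph.one_apply]
    refine (hu _ (hK.image (ρ k⁻¹).continuous) hsub _
      ((ρ k).continuous.continuousAt hU)).mono fun n hn x hx => ?_
    simpa only [map_mul, Homeomorph.mul_apply, mem_preimage] using hn (mem_image_of_mem _ hx)
  refine ⟨fun m n hmn => h.injective (by simpa using hmn), key h.forward, ?_⟩
  have := key h.backward
  simpa only [mul_inv_rev, inv_inv, mul_assoc] using this

/-- Being a convergence sequence of a restricted action can be tested in the larger group. -/
theorem comp_iff {f : H →* G} (hf : Function.Injective f) {u : ℕ → H} :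
    IsConvergenceSequence (ρ.comp f) u r a ↔ IsConvergenceSequence ρ (fun n => f (u n)) r a := by
  constructor
  · exact fun h => ⟨hf.comp h.injective, h.forward, by simpa using h.backward⟩
  · exact fun h => ⟨fun m n hmn => h.injective (congrArg f hmn), h.forward,
      by simpa using h.backward⟩

end IsConvergenceSequence

theorem IsConvergenceAction.comp {G H X : Type*} [Group G] [Group H] [TopologicalSpace X]
    {ρ : G →* (X ≃ₜ X)} (h : IsConvergenceAction ρ) {f : H →* G} (hf : Function.Injective f) :
    IsConvergenceAction (ρ.comp f) where
  three_points := h.three_points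
  exists_subseq u hu := by
    obtain ⟨φ, hφ, r, a, hra⟩ := h.exists_subseq (f ∘ u) (hf.comp hu)
    exact ⟨φ, hφ, r, a, (IsConvergenceSequence.comp_iff hf).2 hra⟩

/-- A non-empty closed invariant set that is not a single point contains the limit set: it has
a point other than the repelling point of a given convergence sequence, and the images of that
point approach the attracting point. -/
theorem convergenceLimitSet_subset {G X : Type*} [Group G] [TopologicalSpace X]
    {ρ : G →* (X ≃ₜ X)} {C : Set X} (hC : IsClosed C) (hnt : C.Nontrivial)
    (hinv : ∀ g, ∀ x ∈ C, ρ g x ∈ C) : convergenceLimitSet ρ ⊆ C := by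
  have key : ∀ {g : ℕ → G} {r a : X}, IsConvergenceSequence ρ g r a → a ∈ C := by
    intro g r a h
    obtain ⟨c, hc, hcr⟩ := hnt.exists_ne r
    exact hC.mem_of_tendsto (h.tendsto hcr) (Eventually.of_forall fun n => hinv _ _ hc)
  rintro x ⟨g, r, a, h, rfl | rfl⟩
  · exact key h.inv
  · exact key h

namespace IsEffectiveMinimalNonelementary

variable {G H X : Type*} [Group G] [Group H] [TopologicalSpace X] {ρ : G →* (X ≃ₜ X)}

theorem infinite_space (h : IsEffectiveMinimalNonelementary ρ) : Infinite X :=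
  Set.infinite_univ_iff.1 (h.nonelementary.mono (subset_univ _))

theorem exists_isConvergenceSequence (h : IsEffectiveMinimalNonelementary ρ) :
    ∃ (g : ℕ → G) (r a : X), IsConvergenceSequence ρ g r a := by
  obtain ⟨_, g, r, a, hg, -⟩ := h.nonelementary.nonempty
  exact ⟨g, r, a, hg⟩

/-- The repelling points of convergence sequences are dense, as they form a non-empty
invariant set. -/
theorem exists_isConvergenceSequence_mem (h : IsEffectiveMinimalNonelementary ρ) {U : Set X}
    (hU : IsOpen U) (hne : U.Nonempty) :
    ∃ (g : ℕ → G) (r a : X), IsConvergenceSequence ρ g r a ∧ r ∈ U := by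
  obtain ⟨g, r, a, hg⟩ := h.exists_isConvergenceSequence
  obtain ⟨_, hyU, k, rfl⟩ := (h.minimal r).inter_open_nonempty U hU hne
  exact ⟨_, _, _, hg.conj k, hyU⟩

theorem infinite_orbit [T1Space X] (h : IsEffectiveMinimalNonelementary ρ) (x : X) :
    (range fun g : G => ρ g x).Infinite := by
  intro hfin
  have := h.infinite_space
  have huniv := (h.minimal x).closure_eq
  rw [hfin.isClosed.closure_eq] at huniv
  exact Set.infinite_univ (huniv ▸ hfin)

/-! ### Normal and subnormal subgroups -/

/-- A non-trivial normal subgroup, given as the range of `f`, has no global fixed point: its global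
fixed points form a closed `G`-invariant set. -/
theorem exists_map_ne [T2Space X] [Nontrivial H] (h : IsEffectiveMinimalNonelementary ρ)
    {f : H →* G} (hf : Function.Injective f) (hn : f.range.Normal) (c : X) :
    ∃ k : H, ρ (f k) c ≠ c := by
  by_contra! hc
  have huniv : {x | ∀ k : H, ρ (f k) x = x} = univ := by
    refine eq_univ_of_isClosed_of_forall_map_mem h.minimal ?_ ⟨c, hc⟩ ?_
    · rw [ofPred_forall]
      exact isClosed_iInter fun k => isClosed_eq (ρ (f k)).continuous continuous_id
    · intro g x hx k
      obtain ⟨k', hk'⟩ := hn.conj_mem (f k) ⟨k, rfl⟩ g⁻¹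
      have hcomm : f k * g = g * f k' := by rw [hk']; group
      rw [← Homeomorph.mul_apply, ← map_mul, hcomm, map_mul, Homeomorph.mul_apply, hx k']
  obtain ⟨k, hk⟩ := exists_ne (1 : H)
  refine hk (hf (h.effective ?_))
  ext x
  have hx : x ∈ {x | ∀ k : H, ρ (f k) x = x} := huniv ▸ mem_univ x
  simpa using hx k

/-- A non-trivial normal subgroup, given as the range of `f`, is infinite. -/
theorem exists_injective_seq [T2Space X] [Nontrivial H] (h : IsEffectiveMinimalNonelementary ρ)
    {f : H →* G} (hf : Function.Injective f) (hn : f.range.Normal) :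
    ∃ u : ℕ → H, Function.Injective u := by
  by_contra! hno
  have := h.infinite_space
  obtain ⟨g, r, a, hg⟩ := h.exists_isConvergenceSequence
  obtain ⟨k, hk⟩ := h.exists_map_ne hf hn a
  have hconj : ∀ n, ∃ k', f k' = (g n)⁻¹ * f k * (g n)⁻¹⁻¹ := fun n =>
    hn.conj_mem (f k) ⟨k, rfl⟩ (g n)⁻¹
  choose u hu using hconj
  obtain ⟨φ, hφ, ⟨k', hk'⟩ | hinj⟩ := exists_strictMono_const_or_injective u
  · -- Here `k * g (φ n) = g (φ n) * k'`. Apply both sides to a point outside `{r, k'⁻¹ r}`.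
    obtain ⟨x, hx⟩ := (Set.toFinite {r, (ρ (f k')).symm r}).exists_notMem
    simp only [mem_insert_iff, mem_singleton_iff, not_or] at hx
    have hx' : ρ (f k') x ≠ r := fun hxr => hx.2 ((ρ (f k')).symm_apply_eq.2 hxr.symm).symm
    have h1 := ((ρ (f k)).continuous.tendsto a).comp
      ((hg.tendsto hx.1).comp hφ.tendsto_atTop)
    have h2 := (hg.tendsto hx').comp hφ.tendsto_atTop
    refine hk (tendsto_nhds_unique h1 (h2.congr fun n => ?_))
    have hcomm : g (φ n) * f k' = f k * g (φ n) := by rw [← hk' n, hu]; group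
    simp only [Function.comp_apply]
    rw [← Homeomorph.mul_apply, ← map_mul, hcomm, map_mul, Homeomorph.mul_apply]
  · exact hno _ hinj

/-- The restriction to a non-trivial normal subgroup, given as the range of `f`. -/
theorem comp [T2Space X] [Nontrivial H] (h : IsEffectiveMinimalNonelementary ρ)
    {f : H →* G} (hf : Function.Injective f) (hn : f.range.Normal) :
    IsEffectiveMinimalNonelementary (ρ.comp f) := by
  have := h.infinite_space
  have hconv := h.convergence.comp hf
  have hdense : Dense (convergenceLimitSet (ρ.comp f)) := by
    obtain ⟨u, hu⟩ := h.exists_injective_seq hf hn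
    obtain ⟨φ, -, r, a, hra⟩ := hconv.exists_subseq u hu
    refine (h.minimal r).mono ?_
    -- Conjugates under `G` of a convergence sequence of `H` are convergence sequences of `H`.
    rintro _ ⟨g, rfl⟩
    choose v hv using fun n => hn.conj_mem (f (u (φ n))) ⟨_, rfl⟩ g
    refine ⟨v, _, ρ g a, (IsConvergenceSequence.comp_iff hf).2 ?_, Or.inl rfl⟩
    simp only [hv]
    exact ((IsConvergenceSequence.comp_iff hf).1 hra).conj g
  refine ⟨hconv, fun hfin => ?_, fun x => ?_, h.effective.comp hf⟩
  · have huniv := hdense.closure_eq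
    rw [hfin.isClosed.closure_eq] at huniv
    exact Set.infinite_univ (huniv ▸ hfin)
  · have hinv : ∀ k, ∀ y ∈ closure (range fun k : H => ρ.comp f k x),
        ρ.comp f k y ∈ closure (range fun k : H => ρ.comp f k x) := by
      intro k y hy
      refine map_mem_closure (ρ.comp f k).continuous hy ?_
      rintro _ ⟨k', rfl⟩
      exact ⟨k * k', by simp⟩
    obtain ⟨k, hk⟩ := h.exists_map_ne hf hn x
    have hnt : (closure (range fun k : H => ρ.comp f k x)).Nontrivial :=
      ⟨_, subset_closure ⟨k, rfl⟩, _, subset_closure ⟨1, by simp⟩, hk⟩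
    exact dense_closure.1 (hdense.mono (convergenceLimitSet_subset isClosed_closure hnt hinv))

theorem of_isSubnormal [T2Space X] (h : IsEffectiveMinimalNonelementary ρ) {N : Subgroup G}
    (hN : N.IsSubnormal) (hne : N ≠ ⊥) : IsEffectiveMinimalNonelementary (ρ.comp N.subtype) := by
  induction hN with
  | top =>
    have := (Subgroup.nontrivial_iff_ne_bot _).2 hne
    refine h.comp (Subgroup.subtype_injective _) ?_
    rw [Subgroup.range_subtype]
    infer_instance
  | step N K hle _ hnormal ih =>
    have := (Subgroup.nontrivial_iff_ne_bot _).2 hne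
    have hK := ih fun hK => hne (le_bot_iff.1 (hK ▸ hle))
    refine hK.comp (f := Subgroup.inclusion hle) (Subgroup.inclusion_injective hle) ?_
    rwa [Subgroup.inclusion_range]

/-! ### The Powers property -/

/-- The action is topologically free: a non-trivial element fixes no non-empty open set
pointwise. -/
theorem dense_map_ne [T2Space X] (h : IsEffectiveMinimalNonelementary ρ) {f : G} (hf : f ≠ 1) :
    Dense {x | ρ f x ≠ x} := by
  have := h.infinite_space
  by_contra hdense
  refine hf (h.effective ?_)
  rw [dense_iff_inter_open] at hdense
  push Not at hdense
  obtain ⟨U, hU, hne, hempty⟩ := hdense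
  have hfix : ∀ x ∈ U, ρ f x = x := fun x hx => by
    by_contra hfx
    exact (hempty ▸ (⟨hx, hfx⟩ : x ∈ U ∩ {x | ρ f x ≠ x}) : x ∈ (∅ : Set X))
  obtain ⟨g, r, a, hg, hr⟩ := h.exists_isConvergenceSequence_mem hU hne
  -- A point `x ≠ a` lies in `g n U` for large `n`, hence is fixed by `g n * f * (g n)⁻¹`.
  have hev : ∀ x, x ≠ a → ∀ᶠ n in atTop, ρ (g n * f * (g n)⁻¹) x = x := fun x hx =>
    ((hg.inv.tendsto hx).eventually (hU.mem_nhds hr)).mono fun n hn => by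
      rw [map_mul, map_mul, Homeomorph.mul_apply, Homeomorph.mul_apply, hfix _ hn,
        ← Homeomorph.mul_apply, ← map_mul, mul_inv_cancel, map_one, Homeomorph.one_apply]
  obtain ⟨φ, hφ, ⟨c, hc⟩ | hinj⟩ :=
    exists_strictMono_const_or_injective fun n => g n * f * (g n)⁻¹
  · have hcfix : ∀ x, x ≠ a → ρ c x = x := fun x hx => by
      obtain ⟨n, hn⟩ := (hφ.tendsto_atTop.eventually (hev x hx)).exists
      rwa [hc] at hn
    have hc1 : ρ c = ρ 1 := by
      ext x
      rw [map_one, Homeomorph.one_apply]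
      by_cases hx : x = a
      · -- The bijection `ρ c` fixes all other points, so it fixes `a` too.
        by_contra hxc
        exact hxc ((ρ c).injective (hcfix _ (hx ▸ hxc)))
      · exact hcfix x hx
    have hc' := hc 0
    rw [h.effective hc1, mul_inv_eq_one, mul_eq_left] at hc'
    rw [hc']
  · exfalso
    obtain ⟨ψ, hψ, r', a', hra⟩ := h.convergence.exists_subseq _ hinj
    -- Two points other than `a` and `r'`: both are eventually fixed, and both tend to `a'`.
    obtain ⟨x, hx⟩ := (Set.toFinite {a, r'}).exists_notMem
    obtain ⟨y, hy⟩ := (Set.toFinite {a, r', x}).exists_notMem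
    simp only [mem_insert_iff, mem_singleton_iff, not_or] at hx hy
    have hlim : ∀ z, z ≠ a → z ≠ r' → z = a' := fun z hza hzr =>
      tendsto_nhds_unique (tendsto_const_nhds.congr'
        (((hφ.comp hψ).tendsto_atTop.eventually (hev z hza)).mono fun n hn => hn.symm))
        (hra.tendsto hzr)
    exact hy.2.2 ((hlim y hy.1 hy.2.1).trans (hlim x hx.1 hx.2).symm)

/-- Some non-empty open set is disjoint from its translates under a given finite set of
non-trivial elements. -/
theorem exists_isOpen_disjoint [T2Space X] [CompactSpace X]
    (h : IsEffectiveMinimalNonelementary ρ) {F : Finset G} (hF : 1 ∉ F) :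
    ∃ U : Set X, IsOpen U ∧ U.Nonempty ∧ ∀ f ∈ F, ∀ x ∈ U, ρ f x ∉ U := by
  have := h.infinite_space
  have hd : Dense (⋂ f ∈ (F : Set G), {x | ρ f x ≠ x}) :=
    dense_biInter_of_isOpen (fun f _ => isOpen_ne_fun (ρ f).continuous continuous_id)
      F.finite_toSet.countable fun f hf => h.dense_map_ne fun hf1 => hF (hf1 ▸ hf)
  obtain ⟨x, hx⟩ := hd.nonempty
  simp only [mem_iInter] at hx
  have hsep : ∀ f ∈ F, ∃ U : Set X, IsOpen U ∧ x ∈ U ∧ ∀ y ∈ U, ρ f y ∉ U := fun f hf => by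
    obtain ⟨V, W, hV, hW, hxV, hxW, hVW⟩ := t2_separation (hx f hf)
    exact ⟨W ∩ ρ f ⁻¹' V, hW.inter (hV.preimage (ρ f).continuous), ⟨hxW, hxV⟩,
      fun y hy hy' => disjoint_left.1 hVW hy.2 hy'.1⟩
  choose! U hU hxU hUd using hsep
  refine ⟨⋂ f ∈ F, U f, isOpen_biInter_finset hU, ⟨x, mem_iInter₂.2 hxU⟩, fun f hf y hy hy' => ?_⟩
  exact hUd f hf y (mem_iInter₂.1 hy f hf) (mem_iInter₂.1 hy' f hf)

theorem isPowersGroup [T2Space X] [CompactSpace X] (h : IsEffectiveMinimalNonelementary ρ) :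
    IsPowersGroup G := by
  intro F hF k _
  obtain ⟨U, hU, hne, hUd⟩ := h.exists_isOpen_disjoint hF
  obtain ⟨g, r, a, hg, hr⟩ := h.exists_isConvergenceSequence_mem hU hne
  -- Elements `t i` moving the attracting point to `k` different points.
  have hinf := h.infinite_orbit a
  let p : Fin k → X := fun i => hinf.natEmbedding _ i
  have hp : Function.Injective p := fun i j hij =>
    Fin.ext ((hinf.natEmbedding _).injective (Subtype.ext hij))
  choose t ht using fun i : Fin k => (hinf.natEmbedding _ (i : ℕ)).2
  have ht' : ∀ i, ρ (t i) a = p i := ht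
  obtain ⟨V, hV, hVd⟩ := (Set.finite_range p).t2_separation
  -- A single `g n` compresses `Uᶜ` into all the neighbourhoods `(t i)⁻¹ V (p i)` of `a`.
  have hev : ∀ᶠ n in atTop, ∀ i, MapsTo (ρ (g n)) Uᶜ (ρ (t i) ⁻¹' V (p i)) :=
    eventually_all.2 fun i => hg.forward Uᶜ hU.isClosed_compl.isCompact
      (fun y hy hyr => hy (hyr ▸ hr)) _
      ((ρ (t i)).continuous.continuousAt ((hV (p i)).2.mem_nhds (ht' i ▸ (hV (p i)).1)))
  obtain ⟨n, hn⟩ := hev.exists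
  have hmem : ∀ i z, z ∉ (fun z => ρ z a) ⁻¹' U → ρ (t i * g n * z) a ∈ V (p i) :=
    fun i z hz => by
      rw [map_mul, map_mul, Homeomorph.mul_apply, Homeomorph.mul_apply]
      exact hn i hz
  refine ⟨(fun z => ρ z a) ⁻¹' U, ((fun z => ρ z a) ⁻¹' U)ᶜ, fun i => t i * g n,
    union_compl_self _, disjoint_compl_right, fun f hf => ?_, fun i j hij => ?_⟩
  · rw [disjoint_left]
    rintro _ ⟨z, hz, rfl⟩ hz'
    refine hUd f hf _ hz ?_
    simpa only [mem_preimage, map_mul, Homeomorph.mul_apply] using hz'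
  · rw [disjoint_left]
    rintro _ ⟨z, hz, rfl⟩ ⟨w, hw, hwz⟩
    refine disjoint_left.1 (hVd (mem_range_self i) (mem_range_self j) (hp.ne hij))
      (hmem i z hz) ?_
    have := hmem j w hw
    simp only at hwz
    rwa [hwz] at this

end IsEffectiveMinimalNonelementary

theorem corollary3p4 {G X : Type*} [Group G] [Countable G]
    [TopologicalSpace X] [CompactSpace X] [TopologicalSpace.MetrizableSpace X]
    (ρ : G →* (X ≃ₜ X)) (hρ : IsEffectiveMinimalNonelementary ρ) :
    (∀ N : Subgroup G, N.IsSubnormal → N ≠ ⊥ →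
      IsEffectiveMinimalNonelementary (ρ.comp N.subtype)) ∧
    IsStronglyPowersGroup G := by
  exact ⟨fun N hN hne => hρ.of_isSubnormal hN hne,
    fun N hN hne => (hρ.of_isSubnormal hN hne).isPowersGroup⟩
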